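/- All distributive lattices are bounded, with least element $0$ and greatest element $1$. A weak Heyting algebra is a distributive lattice $A$ with a binary operation $\to$ such that, for all $a,b,c\in A$, $$a\to a=1,\quad a\to(b\wedge c)=(a\to b)\wedge(a\to c),\quad (a\vee b)\to c=(a\to c)\wedge(b\to c),\quad (a\to b)\wedge(b\to c)\le a\to c .$$ It is a pre-Heyting algebra if moreover $1\to 0=0$ and $(1\to a)\vee(1\to b)=1\to(a\vee b)$ for all $a,b\in A$. Morphisms of pre-Heyting algebras are the bounded lattice homomorphisms that preserve $\to$. A Priestley space is a compact Hausdorff space $X$ with a basis of clopen sets and a partial order $\le$ such that whenever $x\not\le y$ there is a clopen downset $U$ with $y\in U$ and $x\notin U$; morphisms of Priestley spaces are the continuous order-preserving maps. A weak Heyting space is a Priestley space $X$ with a binary relation $R$ such that, writing $R(x)=\{y\in X: xRy\}$, (i) $R(x)$ is closed for each $x\in X$; (ii) if $x\le y$ and $xRz$, then $yRz$; (iii) for each clopen $U\subseteq X$ the sets $\{x\in X: R(x)\subseteq U\}$ and $\{x\in X: R(x)\cap U\ne\emptyset\}$ are clopen. A subset $S$ of a poset is rooted if there is $p\in S$ with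 $q\le p$ for all $q\in S$. A pre-Heyting space is a weak Heyting space in which $R(x)$ is rooted for every $x$. Morphisms $(X,\le,R)\to(X',\le',R')$ of pre-Heyting spaces are the continuous order-preserving maps $f$ with $f(R(x))=R'(f(x))$ for all $x\in X$. For a Priestley space $X$ let $V(X)$ be the set of all closed subsets of $X$ with the topology generated by the subbasis of all sets $\{F\in V(X): F\subseteq U\}$ and $\{F\in V(X): F\cap U\neq\emptyset\}$, $U$ clopen in $X$, and let $V_r(X)$ be its subspace of all closed rooted subsets of $X$, ordered by inclusion. With $V_r(f)(F)=f(F)$ for morphisms $f$, this is an endofunctor of the category of Priestley spaces. Theorem. 1. The category of pre-Heyting algebras is dually equivalent to the category of pre-Heyting spaces. 2. The category of pre-Heyting spaces is isomorphic to the category of coalgebras for the functor $V_r$ on the category of Priestley spaces. -/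

import Mathlib

open CategoryTheory

universe u

namespace PHey

/-! ### Weak Heyting algebras and pre-Heyting algebras -/

/-- A weak Heyting algebra: a bounded distributive lattice with a weak implication. -/
structure WeakHeytAlg : Type (u + 1) where
  lat : BddDistLat.{u}
  imp : lat → lat → lat
  imp_self : ∀ a : lat, imp a a = ⊤
  imp_inf : ∀ a b c : lat, imp a (b ⊓ c) = imp a b ⊓ imp a c
  sup_imp : ∀ a b c : lat, imp (a ⊔ b) c = imp a c ⊓ imp b c
  imp_trans : ∀ a b c : lat, imp a b ⊓ imp b c ≤ imp a c

namespace WeakHeytAlg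

/-- Homomorphisms: bounded lattice homomorphisms that preserve the implication. -/
@[ext]
structure Hom (A B : WeakHeytAlg.{u}) where
  hom : BoundedLatticeHom A.lat B.lat
  map_imp : ∀ a b : A.lat, hom (A.imp a b) = B.imp (hom a) (hom b)

instance : Category WeakHeytAlg.{u} where
  Hom A B := Hom A B
  id A := { hom := BoundedLatticeHom.id A.lat, map_imp := fun _ _ => rfl }
  comp {A B C} f g :=
    { hom := g.hom.comp f.hom
      map_imp := fun a b => by
        simp only [BoundedLatticeHom.comp_apply, f.map_imp, g.map_imp] }

/-- The two additional axioms of pre-Heyting algebras. -/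
def isPreHeyting : ObjectProperty WeakHeytAlg.{u} := fun A =>
  A.imp ⊤ ⊥ = ⊥ ∧ ∀ a b : A.lat, A.imp ⊤ a ⊔ A.imp ⊤ b = A.imp ⊤ (a ⊔ b)

end WeakHeytAlg

/-- The category of pre-Heyting algebras and all weak Heyting homomorphisms between them. -/
abbrev PreHeytAlg : Type (u + 1) := WeakHeytAlg.isPreHeyting.{u}.FullSubcategory

/-! ### Priestley spaces -/

/-- Priestley spaces. The Hausdorff property and the existence of a basis of clopen sets follow from
compactness and the separation axiom; separation by clopen downsets is separation by clopen upsets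
(Mathlib's form), by taking complements. -/
structure PriestleySp : Type (u + 1) where
  carrier : Type u
  [top : TopologicalSpace carrier]
  [order : PartialOrder carrier]
  [compact : CompactSpace carrier]
  [priestley : PriestleySpace carrier]

namespace PriestleySp

instance : CoeSort PriestleySp.{u} (Type u) := ⟨PriestleySp.carrier⟩

attribute [instance] PriestleySp.top PriestleySp.order PriestleySp.compact PriestleySp.priestley

/-- Morphisms of Priestley spaces are the continuous order-preserving maps. -/
instance : Category PriestleySp.{u} where
  Hom X Y := ContinuousOrderHom X Y
  id X := ContinuousOrderHom.id X
  comp f g := ContinuousOrderHom.comp g f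

end PriestleySp

/-- A subset of a poset is rooted if it has a greatest element. -/
def IsRooted {X : Type u} [PartialOrder X] (S : Set X) : Prop :=
  ∃ p ∈ S, ∀ q ∈ S, q ≤ p

/-! ### Weak Heyting spaces and pre-Heyting spaces -/

/-- A weak Heyting space: a Priestley space with a relation `R`; `R(x)` is `{y | R x y}`. -/
structure WeakHeytSp : Type (u + 1) where
  space : PriestleySp.{u}
  R : space → space → Prop
  isClosed_R : ∀ x : space, IsClosed {y | R x y}
  R_mono : ∀ x y z : space, x ≤ y → R x z → R y z
  isClopen_box : ∀ U : Set space, IsClopen U → IsClopen {x | {y | R x y} ⊆ U}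
  isClopen_diamond : ∀ U : Set space, IsClopen U → IsClopen {x | ({y | R x y} ∩ U).Nonempty}

namespace WeakHeytSp

/-- Weak Heyting morphisms: continuous order-preserving maps `f` with `f(R(x)) = R'(f(x))`. -/
@[ext]
structure Hom (X Y : WeakHeytSp.{u}) where
  hom : ContinuousOrderHom X.space Y.space
  image_R : ∀ x : X.space, hom '' {y | X.R x y} = {z | Y.R (hom x) z}

instance : Category WeakHeytSp.{u} where
  Hom X Y := Hom X Y
  id X := { hom := ContinuousOrderHom.id X.space, image_R := fun _ => Set.image_id _ }
  comp {X Y Z} f g :=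
    { hom := g.hom.comp f.hom
      image_R := fun x => by
        rw [ContinuousOrderHom.coe_comp, Set.image_comp, f.image_R, g.image_R]
        rfl }

/-- Every `R(x)` is rooted. -/
def isPreHeyting : ObjectProperty WeakHeytSp.{u} := fun X =>
  ∀ x : X.space, IsRooted {y | X.R x y}

end WeakHeytSp

/-- The category of pre-Heyting spaces and all weak Heyting morphisms between them. -/
abbrev PreHeytSp : Type (u + 1) := WeakHeytSp.isPreHeyting.{u}.FullSubcategory

/-! ### The Vietoris space and its subspace of rooted sets -/

/-- The set of all closed subsets of a topological space. -/
def Vietoris (X : Type u) [TopologicalSpace X] : Type u := {F : Set X // IsClosed F}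

namespace Vietoris

variable {X : Type u} [TopologicalSpace X]

instance : PartialOrder (Vietoris X) := inferInstanceAs (PartialOrder {F : Set X // IsClosed F})

/-- `□U`, the closed sets contained in `U`. -/
def box (U : Set X) : Set (Vietoris X) := {F | F.1 ⊆ U}

/-- `◇U`, the closed sets that meet `U`. -/
def diamond (U : Set X) : Set (Vietoris X) := {F | (F.1 ∩ U).Nonempty}

/-- The subbasis of all `□U` and `◇U` with `U` clopen. -/
def subbasis (X : Type u) [TopologicalSpace X] : Set (Set (Vietoris X)) :=
  {S | ∃ U : Set X, IsClopen U ∧ (S = box U ∨ S = diamond U)}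

instance : TopologicalSpace (Vietoris X) := TopologicalSpace.generateFrom (subbasis X)

theorem isOpen_box {U : Set X} (hU : IsClopen U) : IsOpen (box U) :=
  TopologicalSpace.isOpen_generateFrom_of_mem ⟨U, hU, Or.inl rfl⟩

theorem isOpen_diamond {U : Set X} (hU : IsClopen U) : IsOpen (diamond U) :=
  TopologicalSpace.isOpen_generateFrom_of_mem ⟨U, hU, Or.inr rfl⟩

theorem compl_diamond (U : Set X) : (diamond U)ᶜ = box Uᶜ := by
  ext F
  simp only [diamond, box, Set.mem_compl_iff, Set.mem_ofPred_eq, Set.not_nonempty_iff_eq_empty]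
  exact Set.disjoint_iff_inter_eq_empty.symm.trans Set.subset_compl_iff_disjoint_right.symm

theorem isClopen_diamond {U : Set X} (hU : IsClopen U) : IsClopen (diamond U) :=
  ⟨⟨by rw [compl_diamond]; exact isOpen_box hU.compl⟩, isOpen_diamond hU⟩

instance [CompactSpace X] : CompactSpace (Vietoris X) := by
  refine ⟨isCompact_generateFrom rfl fun S hS hcov => ?_⟩
  let c : Set (Set X) := {U | IsClopen U ∧ diamond U ∈ S}
  have hcl : IsClosed (⋃₀ c)ᶜ := (isOpen_sUnion fun U hU => hU.1.isOpen).isClosed_compl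
  obtain ⟨T, hTS, hT⟩ := Set.mem_sUnion.1 (hcov (Set.mem_univ (⟨_, hcl⟩ : Vietoris X)))
  obtain ⟨U, hU, rfl | rfl⟩ := hS hTS
  · have hsub : Uᶜ ⊆ ⋃₀ c := Set.compl_subset_comm.1 hT
    rw [Set.sUnion_eq_biUnion] at hsub
    obtain ⟨b, hbc, hb, hUb⟩ :=
      hU.compl.isClosed.isCompact.elim_finite_subcover_image (fun V hV => hV.1.isOpen) hsub
    refine ⟨insert (box U) (diamond '' b), ?_, (hb.image _).insert _, ?_⟩
    · rintro _ (rfl | ⟨V, hV, rfl⟩)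
      · exact hTS
      · exact (hbc hV).2
    · intro F _
      by_cases hF : F.1 ⊆ U
      · exact ⟨_, Set.mem_insert _ _, hF⟩
      · obtain ⟨x, hxF, hxU⟩ := Set.not_subset.1 hF
        obtain ⟨V, hV, hxV⟩ := Set.mem_iUnion₂.1 (hUb hxU)
        exact ⟨_, Set.mem_insert_of_mem _ ⟨V, hV, rfl⟩, x, hxF, hxV⟩
  · obtain ⟨x, hx, hxU⟩ := hT
    exact (hx ⟨U, ⟨hU, hTS⟩, hxU⟩).elim

end Vietoris

/-- The subspace of `Vietoris X` of all closed rooted subsets, ordered by inclusion. -/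
def RootedVietoris (X : Type u) [TopologicalSpace X] [PartialOrder X] : Type u :=
  {F : Vietoris X // IsRooted F.1}

namespace RootedVietoris

variable {X : Type u} [TopologicalSpace X] [PartialOrder X]

instance : PartialOrder (RootedVietoris X) :=
  inferInstanceAs (PartialOrder {F : Vietoris X // IsRooted F.1})

instance : TopologicalSpace (RootedVietoris X) :=
  inferInstanceAs (TopologicalSpace {F : Vietoris X // IsRooted F.1})

/-- The underlying closed rooted set. -/
def toSet (F : RootedVietoris X) : Set X := F.1.1

theorem ext {F G : RootedVietoris X} (h : F.toSet = G.toSet) : F = G :=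
  Subtype.ext (Subtype.ext h)

theorem isClosed_setOf_isRooted [CompactSpace X] [PriestleySpace X] :
    IsClosed {F : Vietoris X | IsRooted F.1} := by
  rw [← isOpen_compl_iff, isOpen_iff_forall_mem_open]
  intro F hF
  have h : ∀ p : X, ∃ U : Set X, IsClopen U ∧
      (p ∈ F.1 → IsLowerSet U ∧ p ∈ U ∧ (F.1 ∩ Uᶜ).Nonempty) := by
    intro p
    by_cases hp : p ∈ F.1
    · have : ¬ ∀ q ∈ F.1, q ≤ p := fun hq => hF ⟨p, hp, hq⟩
      push Not at this
      obtain ⟨q, hq, hqp⟩ := this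
      obtain ⟨U, hU, hl, hqU, hpU⟩ := exists_isClopen_lower_of_not_le hqp
      exact ⟨U, hU, fun _ => ⟨hl, hpU, q, hq, hqU⟩⟩
    · exact ⟨∅, isClopen_empty, fun h => (hp h).elim⟩
  choose U hU hUF using h
  obtain ⟨t, ht⟩ := F.2.isCompact.elim_nhds_subcover' (fun p _ => U p)
    (fun p hp => (hU p).isOpen.mem_nhds (hUF p hp).2.1)
  refine ⟨Vietoris.box (⋃ p ∈ t, U p) ∩ ⋂ p ∈ t, Vietoris.diamond (U p)ᶜ, ?_, ?_, ?_, ?_⟩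
  · intro G hG ⟨r, hr, hmax⟩
    obtain ⟨hG, hG'⟩ := hG
    obtain ⟨p, hp, hrp⟩ := Set.mem_iUnion₂.1 (hG hr)
    obtain ⟨q, hq, hqp⟩ := Set.mem_iInter₂.1 hG' p hp
    exact hqp ((hUF p p.2).1 (hmax q hq) hrp)
  · exact (Vietoris.isOpen_box (t.finite_toSet.isClopen_biUnion fun p _ => hU p)).inter
      (isOpen_biInter_finset fun p _ => Vietoris.isOpen_diamond (hU p).compl)
  · exact ht
  · exact Set.mem_iInter₂.2 fun p _ => (hUF p p.2).2.2

instance [CompactSpace X] [PriestleySpace X] : CompactSpace (RootedVietoris X) :=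
  isCompact_iff_compactSpace.1 (isClosed_setOf_isRooted (X := X)).isCompact

instance [CompactSpace X] [PriestleySpace X] : PriestleySpace (RootedVietoris X) where
  priestley {F G} h := by
    obtain ⟨x, hxF, hxG⟩ := Set.not_subset.1 (show ¬ F.1.1 ⊆ G.1.1 from h)
    obtain ⟨U, hU, hxU, hUG⟩ := compact_exists_isClopen_in_isOpen G.1.2.isOpen_compl hxG
    refine ⟨Subtype.val ⁻¹' Vietoris.diamond U,
      (Vietoris.isClopen_diamond hU).preimage continuous_subtype_val, ?_, ⟨x, hxF, hxU⟩, ?_⟩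
    · rintro A B hAB ⟨y, hyA, hyU⟩
      exact ⟨y, hAB hyA, hyU⟩
    · rintro ⟨y, hyG, hyU⟩
      exact hUG hyU hyG

variable {Y : Type u} [TopologicalSpace Y] [PartialOrder Y] [CompactSpace X] [PriestleySpace Y]

/-- The direct image of closed rooted sets under a continuous order-preserving map. -/
def map (f : ContinuousOrderHom X Y) :
    ContinuousOrderHom (RootedVietoris X) (RootedVietoris Y) where
  toFun F := ⟨⟨f '' F.1.1, (F.1.2.isCompact.image f.continuous_toFun).isClosed⟩, by
    obtain ⟨p, hp, hmax⟩ := F.2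
    refine ⟨f p, ⟨p, hp, rfl⟩, ?_⟩
    rintro _ ⟨q, hq, rfl⟩
    exact f.monotone' (hmax q hq)⟩
  monotone' F G h := Set.image_mono (show F.1.1 ⊆ G.1.1 from h)
  continuous_toFun := by
    refine Continuous.subtype_mk (continuous_generateFrom_iff.2 ?_) _
    rintro _ ⟨U, hU, rfl | rfl⟩
    · have h : IsOpen (Subtype.val ⁻¹' Vietoris.box (f ⁻¹' U) : Set (RootedVietoris X)) :=
        (Vietoris.isOpen_box (hU.preimage f.continuous_toFun)).preimage continuous_subtype_val
      refine (congrArg IsOpen (Set.ext fun F => ?_)).mp h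
      exact (Set.image_subset_iff (f := f) (s := F.1.1)).symm
    · have h : IsOpen (Subtype.val ⁻¹' Vietoris.diamond (f ⁻¹' U) : Set (RootedVietoris X)) :=
        (Vietoris.isOpen_diamond (hU.preimage f.continuous_toFun)).preimage continuous_subtype_val
      refine (congrArg IsOpen (Set.ext fun F => ?_)).mp h
      exact (Set.image_inter_nonempty_iff (f := f) (s := F.1.1)).symm

theorem toSet_map (f : ContinuousOrderHom X Y) (F : RootedVietoris X) :
    (map f F).toSet = f '' F.toSet := rfl

end RootedVietoris

/-- The rooted Vietoris functor `V_r` on Priestley spaces: closed rooted subsets, direct image. -/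
def rootedVietoris : PriestleySp.{u} ⥤ PriestleySp.{u} where
  obj X := { carrier := RootedVietoris X }
  map f := RootedVietoris.map f
  map_id _ := ContinuousOrderHom.ext fun _ => RootedVietoris.ext (Set.image_id _)
  map_comp {X Y Z} f g := ContinuousOrderHom.ext fun F => RootedVietoris.ext
    (Set.image_comp (fun y : Y => (show ContinuousOrderHom Y Z from g) y)
      (fun x : X => (show ContinuousOrderHom X Y from f) x) F.toSet)

end PHey

namespace PHey

/-! The coalgebra statement is a matter of unfolding. A relation with closed rooted `R(x)` is a map
`x ↦ R(x)` into `V_r(X)`: condition (ii) is monotonicity, condition (iii) is continuity, and the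
coalgebra square says `f(R(x)) = R'(f(x))`.

The duality enriches Priestley duality. A space goes to its clopen downsets with `U → V = {x | R(x)
∩ U ⊆ V}`. Lattice homomorphisms are preimages under unique Priestley maps (`exists_comap_eq`,
`comap_injective`). A closed set is determined by the sets `Uᶜ ∪ V` that contain it, `U` and `V`
clopen downsets, so preserving `→` amounts to compatibility with the relations (`image_R_iff`).

For essential surjectivity, let `x R y` on prime filters mean that `a → b ∈ x` and `a ∈ y` imply `b
∈ y`. The weak Heyting axioms make `a → b ∈ x` a preorder compatible with the lattice operations,
and a prime filter theorem for such preorders (`exists_of_not_rel`) shows that `→` is recovered from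
`R`. Rootedness of `R(x)` matches the two extra axioms, because a nonempty closed set that is prime
for unions of clopen downsets has a greatest element (`isRooted_of_prime`). -/

theorem RootedVietoris.map_str_eq_iff {X Y : PriestleySp.{u}} (f : ContinuousOrderHom X Y)
    (α : ContinuousOrderHom X (RootedVietoris X)) (β : ContinuousOrderHom Y (RootedVietoris Y)) :
    (RootedVietoris.map f).comp α = β.comp f ↔ ∀ x, f '' (α x).toSet = (β (f x)).toSet :=
  ⟨fun h x => congrArg RootedVietoris.toSet (DFunLike.congr_fun h x),
    fun h => ContinuousOrderHom.ext fun x => RootedVietoris.ext (h x)⟩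

/-! ### Pre-Heyting spaces as coalgebras -/

namespace PreHeytSp

/-- The structure map `x ↦ R(x)` of a pre-Heyting space. -/
def str (X : PreHeytSp.{u}) : ContinuousOrderHom X.obj.space (RootedVietoris X.obj.space) where
  toFun x := ⟨⟨{y | X.obj.R x y}, X.obj.isClosed_R x⟩, X.property x⟩
  monotone' x y h := fun z hz => X.obj.R_mono x y z h hz
  continuous_toFun := by
    refine Continuous.subtype_mk (continuous_generateFrom_iff.2 ?_) _
    rintro _ ⟨U, hU, rfl | rfl⟩
    · exact (X.obj.isClopen_box U hU).isOpen
    · exact (X.obj.isClopen_diamond U hU).isOpen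

/-- A pre-Heyting space as a coalgebra for the rooted Vietoris functor. -/
def toCoalgebra : PreHeytSp.{u} ⥤ Endofunctor.Coalgebra rootedVietoris.{u} where
  obj X := { V := X.obj.space, str := str X }
  map {X Y} f :=
    { f := f.hom.hom
      h := (RootedVietoris.map_str_eq_iff f.hom.hom (str X) (str Y)).2 f.hom.image_R }
  map_id _ := rfl
  map_comp _ _ := rfl

/-- The structure map of a coalgebra as a continuous order-preserving map. -/
def coalgebraStr (V : Endofunctor.Coalgebra rootedVietoris.{u}) :
    ContinuousOrderHom V.V (RootedVietoris V.V) := V.str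

theorem isClopen_preimage_box (V : Endofunctor.Coalgebra rootedVietoris.{u}) {U : Set V.V}
    (hU : IsClopen U) : IsClopen {x | (coalgebraStr V x).toSet ⊆ U} := by
  -- The subbasis only makes `box U` open; it is closed as the complement of `diamond Uᶜ`.
  have h : IsClopen (Vietoris.box U) := by
    rw [← isClopen_compl_iff, ← compl_compl U, ← Vietoris.compl_diamond, compl_compl]
    exact Vietoris.isClopen_diamond hU.compl
  exact (h.preimage continuous_subtype_val).preimage (coalgebraStr V).continuous_toFun

theorem isClopen_preimage_diamond (V : Endofunctor.Coalgebra rootedVietoris.{u}) {U : Set V.V}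
    (hU : IsClopen U) : IsClopen {x | ((coalgebraStr V x).toSet ∩ U).Nonempty} :=
  ((Vietoris.isClopen_diamond hU).preimage continuous_subtype_val).preimage
    (coalgebraStr V).continuous_toFun

/-- A coalgebra for the rooted Vietoris functor as a pre-Heyting space. -/
def ofCoalgebra : Endofunctor.Coalgebra rootedVietoris.{u} ⥤ PreHeytSp.{u} where
  obj V :=
    { obj :=
        { space := V.V
          R := fun x y => y ∈ (coalgebraStr V x).toSet
          isClosed_R := fun x => (coalgebraStr V x).1.2
          R_mono := fun _ _ _ h hz => (coalgebraStr V).monotone' h hz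
          isClopen_box := fun _ hU => isClopen_preimage_box V hU
          isClopen_diamond := fun _ hU => isClopen_preimage_diamond V hU }
      property := fun x => (coalgebraStr V x).2 }
  map {V W} f :=
    ObjectProperty.homMk
      { hom := f.f
        image_R := (RootedVietoris.map_str_eq_iff f.f (coalgebraStr V) (coalgebraStr W)).1 f.h }
  map_id _ := rfl
  map_comp _ _ := rfl

/-- The isomorphism of categories between pre-Heyting spaces and coalgebras for `V_r`. -/
def isoCoalgebra :
    Cat.of PreHeytSp.{u} ≅ Cat.of (Endofunctor.Coalgebra rootedVietoris.{u}) where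
  hom := toCoalgebra.toCatHom
  inv := ofCoalgebra.toCatHom
  hom_inv_id := rfl
  inv_hom_id := rfl

end PreHeytSp
-- Compactness arguments for clopen and closed sets
section Clopen

variable {X : Type u} [TopologicalSpace X] [CompactSpace X]

/-- A property closed under finite intersections holds for a clopen set that is separated from every
outer point by clopen sets from a family closed under finite unions that have the property. -/
theorem clopen_induction_of_separating {W : Set X} (hW : IsClopen W) (𝒞 : Set (Set X))
    (hcl : ∀ C ∈ 𝒞, IsClopen C) (hempty : ∅ ∈ 𝒞) (hunion : ∀ C ∈ 𝒞, ∀ D ∈ 𝒞, C ∪ D ∈ 𝒞)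
    (hsep : ∀ x ∈ W, ∀ y ∉ W, ∃ C ∈ 𝒞, x ∈ C ∧ y ∉ C) (P : Set X → Prop)
    (huniv : P Set.univ) (hinter : ∀ C D, P C → P D → P (C ∩ D)) (hP : ∀ C ∈ 𝒞, P C) : P W := by
  -- Compactness of `W`, with unions, removes the dependence on `x`; compactness of `Wᶜ`, with
  -- intersections, then removes that on `y`.
  have h1 : ∀ y ∉ W, ∃ C ∈ 𝒞, W ⊆ C ∧ y ∉ C := by
    intro y hy
    refine hW.isClosed.isCompact.induction_on (p := fun S => ∃ C ∈ 𝒞, S ⊆ C ∧ y ∉ C)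
      ⟨∅, hempty, subset_rfl, id⟩ ?_ ?_ ?_
    · rintro S T hST ⟨C, hC, hTC, hyC⟩
      exact ⟨C, hC, hST.trans hTC, hyC⟩
    · rintro S T ⟨C, hC, hSC, hyC⟩ ⟨D, hD, hTD, hyD⟩
      exact ⟨C ∪ D, hunion C hC D hD, Set.union_subset_union hSC hTD, fun h => h.elim hyC hyD⟩
    · intro x hx
      obtain ⟨C, hC, hxC, hyC⟩ := hsep x hx y hy
      exact ⟨C, mem_nhdsWithin_of_mem_nhds ((hcl C hC).isOpen.mem_nhds hxC), C, hC, subset_rfl, hyC⟩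
  have h2 : ∃ C, P C ∧ W ⊆ C ∧ Wᶜ ⊆ Cᶜ := by
    refine hW.compl.isClosed.isCompact.induction_on (p := fun S => ∃ C, P C ∧ W ⊆ C ∧ S ⊆ Cᶜ)
      ⟨Set.univ, huniv, Set.subset_univ _, Set.empty_subset _⟩ ?_ ?_ ?_
    · rintro S T hST ⟨C, hC, hWC, hTC⟩
      exact ⟨C, hC, hWC, hST.trans hTC⟩
    · rintro S T ⟨C, hC, hWC, hSC⟩ ⟨D, hD, hWD, hTD⟩
      refine ⟨C ∩ D, hinter C D hC hD, Set.subset_inter hWC hWD, ?_⟩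
      rw [Set.compl_inter]
      exact Set.union_subset_union hSC hTD
    · intro y hy
      obtain ⟨C, hC, hWC, hyC⟩ := h1 y hy
      exact ⟨Cᶜ, mem_nhdsWithin_of_mem_nhds ((hcl C hC).compl.isOpen.mem_nhds hyC), C, hP C hC, hWC,
        subset_rfl⟩
  obtain ⟨C, hC, hWC, hCW⟩ := h2
  rwa [hWC.antisymm (Set.compl_subset_compl.1 hCW)]

/-- A clopen set belongs to every bounded sublattice of clopen sets that separates its points from
the points outside. -/
theorem clopen_mem_of_separating {W : Set X} (hW : IsClopen W) (𝒞 : Set (Set X))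
    (hcl : ∀ C ∈ 𝒞, IsClopen C) (hempty : ∅ ∈ 𝒞) (huniv : Set.univ ∈ 𝒞)
    (hunion : ∀ C ∈ 𝒞, ∀ D ∈ 𝒞, C ∪ D ∈ 𝒞) (hinter : ∀ C ∈ 𝒞, ∀ D ∈ 𝒞, C ∩ D ∈ 𝒞)
    (hsep : ∀ x ∈ W, ∀ y ∉ W, ∃ C ∈ 𝒞, x ∈ C ∧ y ∉ C) : W ∈ 𝒞 :=
  clopen_induction_of_separating hW 𝒞 hcl hempty hunion hsep (· ∈ 𝒞) huniv
    (fun C D hC hD => hinter C hC D hD) fun _ h => h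

/-- Induction on clopen sets, from a point-separating bounded lattice `𝓑` of clopen sets. -/
theorem clopen_induction_of_lattice {W : Set X} (hW : IsClopen W) (𝓑 : Set (Set X))
    (hcl : ∀ C ∈ 𝓑, IsClopen C) (hempty : ∅ ∈ 𝓑) (huniv : Set.univ ∈ 𝓑)
    (hunion : ∀ C ∈ 𝓑, ∀ D ∈ 𝓑, C ∪ D ∈ 𝓑) (hinter : ∀ C ∈ 𝓑, ∀ D ∈ 𝓑, C ∩ D ∈ 𝓑)
    (hsep : ∀ x y, x ≠ y → ∃ C ∈ 𝓑, (x ∈ C ∧ y ∉ C) ∨ (y ∈ C ∧ x ∉ C)) (P : Set X → Prop)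
    (hPuniv : P Set.univ) (hPinter : ∀ C D, P C → P D → P (C ∩ D))
    (hP : ∀ C ∈ 𝓑, ∀ D ∈ 𝓑, P (Cᶜ ∪ D)) : P W := by
  refine clopen_induction_of_separating hW {S | ∃ C ∈ 𝓑, ∃ D ∈ 𝓑, S = Cᶜ ∪ D} ?_ ?_ ?_ ?_ P hPuniv
    hPinter ?_
  · rintro _ ⟨C, hC, D, hD, rfl⟩
    exact (hcl C hC).compl.union (hcl D hD)
  · exact ⟨_, huniv, _, hempty, by simp⟩
  · rintro _ ⟨C, hC, D, hD, rfl⟩ _ ⟨C', hC', D', hD', rfl⟩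
    refine ⟨C ∩ C', hinter _ hC _ hC', D ∪ D', hunion _ hD _ hD', ?_⟩
    rw [Set.compl_inter, Set.union_union_union_comm]
  · intro x hx y hy
    obtain ⟨C, hC, h | h⟩ := hsep x y (by rintro rfl; exact hy hx)
    · exact ⟨_, ⟨_, huniv, C, hC, rfl⟩, by simpa using h⟩
    · exact ⟨_, ⟨C, hC, _, hempty, rfl⟩, by simpa using h.symm⟩
  · rintro _ ⟨C, hC, D, hD, rfl⟩
    exact hP C hC D hD

/-- Two closed sets are equal if the same clopen sets contain them. -/
theorem closed_eq_of_clopen [T2Space X] [TotallyDisconnectedSpace X] {S T : Set X}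
    (hS : IsClosed S) (hT : IsClosed T) (h : ∀ W, IsClopen W → (S ⊆ W ↔ T ⊆ W)) : S = T := by
  have key : ∀ {S T : Set X}, IsClosed T → (∀ W, IsClopen W → T ⊆ W → S ⊆ W) → S ⊆ T := by
    intro S T hT h x hx
    by_contra hxT
    obtain ⟨U, hU, hxU, hUT⟩ := compact_exists_isClopen_in_isOpen hT.isOpen_compl hxT
    exact h Uᶜ hU.compl (fun y hy hyU => hUT hyU hy) hx hxU
  exact (key hT fun W hW => (h W hW).2).antisymm (key hS fun W hW => (h W hW).1)

variable [PartialOrder X] [PriestleySpace X]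

/-- Induction on clopen sets of a Priestley space, from its clopen downsets. -/
theorem clopen_induction {W : Set X} (hW : IsClopen W) (P : Set X → Prop)
    (hPuniv : P Set.univ) (hPinter : ∀ C D, P C → P D → P (C ∩ D))
    (hP : ∀ C D, IsClopen C → IsLowerSet C → IsClopen D → IsLowerSet D → P (Cᶜ ∪ D)) : P W := by
  refine clopen_induction_of_lattice hW {C | IsClopen C ∧ IsLowerSet C} (fun C hC => hC.1)
    ⟨isClopen_empty, isLowerSet_empty⟩ ⟨isClopen_univ, isLowerSet_univ⟩
    (fun C hC D hD => ⟨hC.1.union hD.1, hC.2.union hD.2⟩)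
    (fun C hC D hD => ⟨hC.1.inter hD.1, hC.2.inter hD.2⟩) ?_ P hPuniv hPinter
    (fun C hC D hD => hP C D hC.1 hC.2 hD.1 hD.2)
  intro x y hxy
  by_cases h : x ≤ y
  · obtain ⟨U, hU, hl, h1, h2⟩ := exists_isClopen_lower_of_not_le fun h' => hxy (h.antisymm h')
    exact ⟨U, ⟨hU, hl⟩, .inl ⟨h2, h1⟩⟩
  · obtain ⟨U, hU, hl, h1, h2⟩ := exists_isClopen_lower_of_not_le h
    exact ⟨U, ⟨hU, hl⟩, .inr ⟨h2, h1⟩⟩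

/-- A nonempty closed set that is prime for unions of clopen downsets is rooted. -/
theorem isRooted_of_prime {S : Set X} (hS : IsClosed S) (hne : S.Nonempty)
    (h : ∀ C D, IsClopen C → IsLowerSet C → IsClopen D → IsLowerSet D → S ⊆ C ∪ D →
      S ⊆ C ∨ S ⊆ D) : IsRooted S := by
  by_contra hr
  -- Without a greatest element, each point of `S` lies in a clopen downset omitting some point of
  -- `S`. Primeness keeps finite unions from covering `S`, while compactness forces one of them to
  -- cover it.
  have : ∃ C, (IsClopen C ∧ IsLowerSet C ∧ ¬ S ⊆ C) ∧ S ⊆ C := by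
    refine hS.isCompact.induction_on
      (p := fun T => ∃ C, (IsClopen C ∧ IsLowerSet C ∧ ¬ S ⊆ C) ∧ T ⊆ C) ?_ ?_ ?_ ?_
    · exact ⟨∅, ⟨isClopen_empty, isLowerSet_empty, fun h => hne.ne_empty (Set.subset_empty_iff.1 h)⟩,
        subset_rfl⟩
    · rintro T T' hT ⟨C, hC, hTC⟩
      exact ⟨C, hC, hT.trans hTC⟩
    · rintro T T' ⟨C, hC, hTC⟩ ⟨D, hD, hTD⟩
      exact ⟨C ∪ D, ⟨hC.1.union hD.1, hC.2.1.union hD.2.1, fun hCD =>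
        (h C D hC.1 hC.2.1 hD.1 hD.2.1 hCD).elim hC.2.2 hD.2.2⟩, Set.union_subset_union hTC hTD⟩
    · intro p hp
      have : ¬ ∀ q ∈ S, q ≤ p := fun hq => hr ⟨p, hp, hq⟩
      push Not at this
      obtain ⟨q, hq, hqp⟩ := this
      obtain ⟨U, hU, hl, hqU, hpU⟩ := exists_isClopen_lower_of_not_le hqp
      exact ⟨U, mem_nhdsWithin_of_mem_nhds (hU.isOpen.mem_nhds hpU), U,
        ⟨hU, hl, fun h => hqU (h hq)⟩, subset_rfl⟩
  obtain ⟨C, hC, hSC⟩ := this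
  exact hC.2.2 hSC

end Clopen
-- Clopen downsets and Priestley maps
/-- The clopen downsets of an ordered topological space. -/
structure ClopenDown (X : Type u) [TopologicalSpace X] [PartialOrder X] : Type u where
  toSet : Set X
  prop : IsClopen toSet ∧ IsLowerSet toSet

namespace ClopenDown

variable {X : Type u} [TopologicalSpace X] [PartialOrder X]

theorem toSet_injective : Function.Injective (toSet (X := X)) := by
  rintro ⟨U, hU⟩ ⟨V, hV⟩ rfl
  rfl

instance : PartialOrder (ClopenDown X) := PartialOrder.lift toSet toSet_injective

instance : Max (ClopenDown X) :=
  ⟨fun U V => ⟨U.1 ∪ V.1, U.2.1.union V.2.1, U.2.2.union V.2.2⟩⟩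

instance : Min (ClopenDown X) :=
  ⟨fun U V => ⟨U.1 ∩ V.1, U.2.1.inter V.2.1, U.2.2.inter V.2.2⟩⟩

instance : DistribLattice (ClopenDown X) :=
  Function.Injective.distribLattice (β := Set X) toSet toSet_injective Iff.rfl Iff.rfl
    (fun _ _ => rfl) fun _ _ => rfl

instance : BoundedOrder (ClopenDown X) where
  top := ⟨Set.univ, isClopen_univ, isLowerSet_univ⟩
  le_top U := Set.subset_univ U.1
  bot := ⟨∅, isClopen_empty, isLowerSet_empty⟩
  bot_le U := Set.empty_subset U.1

theorem ext {U V : ClopenDown X} (h : ∀ x, x ∈ U.1 ↔ x ∈ V.1) : U = V :=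
  toSet_injective (Set.ext h)

theorem le_iff {U V : ClopenDown X} : U ≤ V ↔ ∀ x, x ∈ U.1 → x ∈ V.1 := Iff.rfl
theorem mem_sup {U V : ClopenDown X} {x : X} : x ∈ (U ⊔ V).1 ↔ x ∈ U.1 ∨ x ∈ V.1 := Iff.rfl
theorem mem_inf {U V : ClopenDown X} {x : X} : x ∈ (U ⊓ V).1 ↔ x ∈ U.1 ∧ x ∈ V.1 := Iff.rfl
theorem mem_top (x : X) : x ∈ (⊤ : ClopenDown X).1 := trivial
theorem notMem_bot (x : X) : x ∉ (⊥ : ClopenDown X).1 := fun h => h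

variable {Y : Type u} [TopologicalSpace Y] [PartialOrder Y]

/-- The preimage homomorphism of a continuous order-preserving map. -/
def comap (f : ContinuousOrderHom X Y) : BoundedLatticeHom (ClopenDown Y) (ClopenDown X) where
  toFun U := ⟨f ⁻¹' U.1, U.2.1.preimage f.continuous_toFun, U.2.2.preimage f.monotone'⟩
  map_sup' _ _ := rfl
  map_inf' _ _ := rfl
  map_top' := rfl
  map_bot' := rfl

theorem mem_comap (f : ContinuousOrderHom X Y) (U : ClopenDown Y) (x : X) :
    x ∈ (comap f U).1 ↔ f x ∈ U.1 := Iff.rfl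

theorem exists_of_not_le [CompactSpace X] [PriestleySpace X] {x y : X} (h : ¬ x ≤ y) :
    ∃ U : ClopenDown X, y ∈ U.1 ∧ x ∉ U.1 := by
  obtain ⟨U, hU, hl, h1, h2⟩ := exists_isClopen_lower_of_not_le h
  exact ⟨⟨U, hU, hl⟩, h2, h1⟩

theorem le_of_forall [CompactSpace X] [PriestleySpace X] {x y : X}
    (h : ∀ U : ClopenDown X, y ∈ U.1 → x ∈ U.1) : x ≤ y := by
  by_contra hxy
  obtain ⟨U, h1, h2⟩ := exists_of_not_le hxy
  exact h2 (h U h1)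

/-- Every prime filter of clopen downsets of a Priestley space is given by a point. -/
theorem exists_point [CompactSpace Y] (φ : BoundedLatticeHom (ClopenDown Y) (ClopenDown X))
    (x : X) :
    ∃ y : Y, ∀ U : ClopenDown Y, y ∈ U.1 ↔ x ∈ (φ U).1 := by
  -- The point sought lies in `U \ V` for every `U` in the prime filter and `V` outside it. These
  -- sets are directed, and nonempty since `U ≤ V` would give `φ U ≤ φ V`.
  let ι := {p : ClopenDown Y × ClopenDown Y // x ∈ (φ p.1).1 ∧ x ∉ (φ p.2).1}
  have : Nonempty ι :=
    ⟨⟨(⊤, ⊥), by rw [map_top]; exact mem_top x, by rw [map_bot]; exact notMem_bot x⟩⟩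
  have key : (⋂ i : ι, i.1.1.1 \ i.1.2.1).Nonempty := by
    have hcl : ∀ i : ι, IsClosed (i.1.1.1 \ i.1.2.1) := fun i =>
      (i.1.1.2.1.diff i.1.2.2.1).isClosed
    refine IsCompact.nonempty_iInter_of_directed_nonempty_isCompact_isClosed _ ?_ ?_
      (fun i => (hcl i).isCompact) hcl
    · rintro ⟨⟨U, V⟩, hU, hV⟩ ⟨⟨U', V'⟩, hU', hV'⟩
      refine ⟨⟨(U ⊓ U', V ⊔ V'), ?_, ?_⟩, ?_, ?_⟩
      · rw [map_inf]; exact ⟨hU, hU'⟩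
      · rw [map_sup]; exact fun h => h.elim hV hV'
      · exact fun y hy => ⟨hy.1.1, fun h => hy.2 (.inl h)⟩
      · exact fun y hy => ⟨hy.1.2, fun h => hy.2 (.inr h)⟩
    · rintro ⟨⟨U, V⟩, hU, hV⟩
      by_contra h
      exact hV ((OrderHomClass.mono φ : Monotone φ)
        (show U ≤ V from Set.sdiff_eq_empty.1 (Set.not_nonempty_iff_eq_empty.1 h)) hU)
  obtain ⟨y, hy⟩ := key
  rw [Set.mem_iInter] at hy
  refine ⟨y, fun U => ⟨fun h => ?_, fun h => ?_⟩⟩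
  · by_contra hx
    exact (hy ⟨(⊤, U), by rw [map_top]; exact mem_top x, hx⟩).2 h
  · exact (hy ⟨(U, ⊥), h, by rw [map_bot]; exact notMem_bot x⟩).1

theorem exists_comap_eq [CompactSpace X] [PriestleySpace X] [CompactSpace Y] [PriestleySpace Y]
    (φ : BoundedLatticeHom (ClopenDown Y) (ClopenDown X)) :
    ∃ f : ContinuousOrderHom X Y, comap f = φ := by
  choose f hf using exists_point φ
  refine ⟨{ toFun := f, monotone' := ?_, continuous_toFun := ?_ }, ?_⟩
  · intro x y hxy
    exact le_of_forall fun U hU => (hf _ U).2 ((φ U).2.2 hxy ((hf _ U).1 hU))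
  -- Only preimages of clopen downsets are known, namely the sets `φ C`; `clopen_induction` extends
  -- this to all clopen sets.
  · have h : ∀ W : Set Y, IsClopen W → IsClopen (f ⁻¹' W) := by
      intro W hW
      refine clopen_induction hW (fun W => IsClopen (f ⁻¹' W)) isClopen_univ
        (fun C D hC hD => hC.inter hD) ?_
      have h' : ∀ C : ClopenDown Y, IsClopen (f ⁻¹' C.1) := by
        intro C
        rw [show f ⁻¹' C.1 = (φ C).1 from Set.ext fun x => hf x C]
        exact (φ C).2.1
      exact fun C D hC hC' hD hD' => (h' ⟨C, hC, hC'⟩).compl.union (h' ⟨D, hD, hD'⟩)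
    exact (isTopologicalBasis_isClopen (X := Y)).continuous_iff.2 fun W hW => (h W hW).isOpen
  · exact DFunLike.ext _ _ fun U => ClopenDown.ext fun x => hf x U

theorem comap_injective [CompactSpace Y] [PriestleySpace Y] {f g : ContinuousOrderHom X Y}
    (h : comap f = comap g) : f = g := by
  have h' : ∀ (U : ClopenDown Y) x, f x ∈ U.1 ↔ g x ∈ U.1 := fun U x => by
    rw [← mem_comap, ← mem_comap, h]
  exact ContinuousOrderHom.ext fun x => le_antisymm (le_of_forall fun U => (h' U x).2)
    (le_of_forall fun U => (h' U x).1)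

end ClopenDown

/-! ### From spaces to algebras -/

namespace WeakHeytSp

/-- The weak implication on the clopen downsets of a weak Heyting space. -/
def imp (X : WeakHeytSp.{u}) (U V : ClopenDown X.space) : ClopenDown X.space :=
  ⟨{x | {y | X.R x y} ⊆ U.1ᶜ ∪ V.1}, X.isClopen_box _ (U.2.1.compl.union V.2.1),
    fun _ _ hab ha _ hy => ha (X.R_mono _ _ _ hab hy)⟩

theorem mem_imp (X : WeakHeytSp.{u}) {U V : ClopenDown X.space} {x : X.space} :
    x ∈ (X.imp U V).1 ↔ ∀ y, X.R x y → y ∈ U.1 → y ∈ V.1 :=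
  forall₂_congr fun _ _ => imp_iff_not_or.symm

/-- The weak Heyting algebra of clopen downsets of a weak Heyting space. -/
def clopenDown (X : WeakHeytSp.{u}) : WeakHeytAlg.{u} where
  lat := BddDistLat.of (ClopenDown X.space)
  imp := X.imp
  imp_self U := ClopenDown.ext fun x => by
    simp only [mem_imp, ClopenDown.mem_top, iff_true]
    exact fun _ _ h => h
  imp_inf U V W := ClopenDown.ext fun x => by
    simp only [mem_imp, ClopenDown.mem_inf]
    grind
  sup_imp U V W := ClopenDown.ext fun x => by
    simp only [mem_imp, ClopenDown.mem_inf, ClopenDown.mem_sup]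
    grind
  imp_trans U V W := ClopenDown.le_iff.2 fun x => by
    simp only [mem_imp, ClopenDown.mem_inf]
    grind

/-- A downset contains `R(x)` as soon as it contains the root, so covering `R(x)` by a union of two
downsets is decided at one point. -/
theorem isPreHeyting_clopenDown (X : WeakHeytSp.{u}) (h : X.isPreHeyting) :
    X.clopenDown.isPreHeyting := by
  refine ⟨ClopenDown.ext fun x => ?_, fun U V => ClopenDown.ext fun x => ?_⟩
  · refine (X.mem_imp).trans ⟨fun hx => ?_, fun hx => hx.elim⟩
    obtain ⟨p, hp, -⟩ := h x
    exact hx p hp (ClopenDown.mem_top p)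
  · refine ClopenDown.mem_sup.trans ((or_congr X.mem_imp X.mem_imp).trans (Iff.trans ?_
      X.mem_imp.symm))
    refine ⟨fun hx y hy _ => hx.imp (fun h => h y hy trivial) (fun h => h y hy trivial), fun hx => ?_⟩
    obtain ⟨p, hp, hmax⟩ := h x
    exact (hx p hp trivial).imp (fun hU y hy _ => U.2.2 (hmax y hy) hU)
      (fun hV y hy _ => V.2.2 (hmax y hy) hV)

/-- Compatibility with the relations is preservation of the implication by preimages. -/
theorem image_R_iff {X Y : WeakHeytSp.{u}} (f : ContinuousOrderHom X.space Y.space) :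
    (∀ x, f '' {y | X.R x y} = {z | Y.R (f x) z}) ↔
      ∀ U V, ClopenDown.comap f (Y.imp U V) = X.imp (ClopenDown.comap f U) (ClopenDown.comap f V) := by
  constructor
  · intro h U V
    refine ClopenDown.ext fun x => ?_
    change {z | Y.R (f x) z} ⊆ _ ↔ _
    rw [← h x, Set.image_subset_iff]
    rfl
  · intro h x
    refine closed_eq_of_clopen ((X.isClosed_R x).isCompact.image f.continuous_toFun).isClosed
      (Y.isClosed_R _) fun W hW => ?_
    refine clopen_induction hW (fun W => f '' {y | X.R x y} ⊆ W ↔ {z | Y.R (f x) z} ⊆ W)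
      (by simp only [Set.subset_univ]) (fun C D hC hD => by
        simp only [Set.subset_inter_iff, hC, hD]) fun C D hC hC' hD hD' => ?_
    rw [Set.image_subset_iff]
    have := congrArg (fun U => x ∈ U.1) (h ⟨C, hC, hC'⟩ ⟨D, hD, hD'⟩)
    exact this.symm.to_iff

end WeakHeytSp

/-- The functor of clopen downsets from pre-Heyting spaces to pre-Heyting algebras. -/
def clopenDownFunctor : PreHeytSp.{u} ⥤ PreHeytAlg.{u}ᵒᵖ where
  obj X := .op ⟨X.obj.clopenDown, X.obj.isPreHeyting_clopenDown X.property⟩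
  map f := Quiver.Hom.op (ObjectProperty.homMk
    { hom := ClopenDown.comap f.hom.hom
      map_imp := (WeakHeytSp.image_R_iff f.hom.hom).1 f.hom.image_R })
  map_id _ := rfl
  map_comp _ _ := rfl

instance : clopenDownFunctor.{u}.Faithful where
  map_injective {X Y f g} h := by
    have h' := congrArg (fun k : clopenDownFunctor.obj X ⟶ clopenDownFunctor.obj Y =>
      WeakHeytAlg.Hom.hom (Quiver.Hom.unop k).hom) h
    exact ObjectProperty.hom_ext _ (WeakHeytSp.Hom.ext (ClopenDown.comap_injective h'))

instance : clopenDownFunctor.{u}.Full where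
  map_surjective {X Y} g := by
    obtain ⟨f, hf⟩ := ClopenDown.exists_comap_eq (X := X.obj.space) (Y := Y.obj.space)
      g.unop.hom.hom
    refine ⟨ObjectProperty.homMk ⟨f, (WeakHeytSp.image_R_iff f).2 fun U V => ?_⟩,
      Quiver.Hom.unop_inj (ObjectProperty.hom_ext _ (WeakHeytAlg.Hom.ext hf))⟩
    rw [hf]
    exact g.unop.hom.map_imp U V

/-! ### The prime spectrum -/

/-- The prime spectrum of a bounded distributive lattice, as its two-valued homomorphisms. -/
structure Spec (A : Type u) [DistribLattice A] [BoundedOrder A] : Type u where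
  val : A → Bool
  prop : (val ⊤ = true ∧ val ⊥ = false) ∧ (∀ a b, val (a ⊔ b) = (val a || val b)) ∧
    ∀ a b, val (a ⊓ b) = (val a && val b)

namespace Spec

variable {A : Type u} [DistribLattice A] [BoundedOrder A]

theorem val_injective : Function.Injective (val (A := A)) := by
  rintro ⟨x, hx⟩ ⟨y, hy⟩ rfl
  rfl

instance : TopologicalSpace (Spec A) := TopologicalSpace.induced val inferInstance

theorem continuous_val : Continuous (val (A := A)) := continuous_induced_dom

theorem continuous_eval (a : A) : Continuous fun x : Spec A => x.val a :=
  (continuous_apply a).comp continuous_val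

instance : CompactSpace (Spec A) := by
  have hr : Set.range (val (A := A)) = {x | (x ⊤ = true ∧ x ⊥ = false) ∧
      (∀ a b, x (a ⊔ b) = (x a || x b)) ∧ ∀ a b, x (a ⊓ b) = (x a && x b)} :=
    Set.ext fun x => ⟨by rintro ⟨y, rfl⟩; exact y.prop, fun hx => ⟨⟨x, hx⟩, rfl⟩⟩
  have h2 (g : Bool → Bool → Bool) (a b : A) : Continuous fun x : A → Bool => g (x a) (x b) := by
    have hg : Continuous fun p : Bool × Bool => g p.1 p.2 := continuous_of_discreteTopology
    have happ (a : A) : Continuous fun x : A → Bool => x a := continuous_apply a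
    exact hg.comp ((happ a).prodMk (happ b))
  have hcl : IsClosed (Set.range (val (A := A))) := by
    rw [hr]
    simp only [Set.ofPred_and, Set.ofPred_forall]
    refine IsClosed.inter (IsClosed.inter ?_ ?_) (IsClosed.inter ?_ ?_)
    · exact isClosed_eq (continuous_apply _) continuous_const
    · exact isClosed_eq (continuous_apply _) continuous_const
    · exact isClosed_iInter fun a => isClosed_iInter fun b =>
        isClosed_eq (continuous_apply _) (h2 or a b)
    · exact isClosed_iInter fun a => isClosed_iInter fun b =>
        isClosed_eq (continuous_apply _) (h2 and a b)
  exact (Topology.IsClosedEmbedding.mk ⟨⟨rfl⟩, val_injective⟩ hcl).compactSpace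

/-- Points are ordered by reverse inclusion of the corresponding prime filters. -/
instance : PartialOrder (Spec A) where
  le x y := ∀ a, y.val a = true → x.val a = true
  le_refl _ _ h := h
  le_trans _ _ _ h h' a ha := h a (h' a ha)
  le_antisymm _ _ h h' := val_injective (funext fun a => Bool.eq_iff_iff.2 ⟨h' a, h a⟩)

theorem val_mono (x : Spec A) {a b : A} (h : a ≤ b) (ha : x.val a = true) : x.val b = true := by
  rw [← sup_eq_right.2 h, x.prop.2.1, ha, Bool.true_or]

theorem isClopen_cyl (a : A) : IsClopen {x : Spec A | x.val a = true} :=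
  (isClopen_discrete {true}).preimage (continuous_eval a)

/-- The clopen downset of all points that contain a given element. -/
def cyl (a : A) : ClopenDown (Spec A) :=
  ⟨{x | x.val a = true}, isClopen_cyl a, fun _ _ h hx => h a hx⟩

theorem mem_cyl {a : A} {x : Spec A} : x ∈ (cyl a).1 ↔ x.val a = true := Iff.rfl

instance : PriestleySpace (Spec A) where
  priestley {x y} h := by
    have h' : ¬ ∀ a, y.val a = true → x.val a = true := h
    push Not at h'
    obtain ⟨a, hy, hx⟩ := h'
    exact ⟨(cyl a).1ᶜ, (cyl a).2.1.compl, (cyl a).2.2.compl, hx, fun h => h hy⟩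

/-- The homomorphism from a bounded distributive lattice to the clopen downsets of its spectrum. -/
def cylHom : BoundedLatticeHom A (ClopenDown (Spec A)) where
  toFun := cyl
  map_sup' a b := ClopenDown.ext fun x => by
    simp only [mem_cyl, ClopenDown.mem_sup, x.prop.2.1, Bool.or_eq_true]
  map_inf' a b := ClopenDown.ext fun x => by
    simp only [mem_cyl, ClopenDown.mem_inf, x.prop.2.2, Bool.and_eq_true]
  map_top' := ClopenDown.ext fun x => iff_of_true x.prop.1.1 (ClopenDown.mem_top x)
  map_bot' := ClopenDown.ext fun x => iff_of_false
    (fun h => Bool.false_ne_true (x.prop.1.2.symm.trans h)) (ClopenDown.notMem_bot x)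

theorem exists_cyl_of_not_le {x y : Spec A} (h : ¬ y ≤ x) :
    ∃ a : A, x ∈ (cyl a).1 ∧ y ∉ (cyl a).1 := by
  have h' : ¬ ∀ a, x.val a = true → y.val a = true := h
  push Not at h'
  exact h'

theorem range_cyl_union (C : Set (Spec A)) (hC : C ∈ Set.range fun a : A => (cyl a).1)
    (D : Set (Spec A)) (hD : D ∈ Set.range fun a : A => (cyl a).1) :
    C ∪ D ∈ Set.range fun a : A => (cyl a).1 := by
  obtain ⟨a, rfl⟩ := hC
  obtain ⟨b, rfl⟩ := hD
  exact ⟨a ⊔ b, congrArg ClopenDown.toSet (cylHom.map_sup' a b)⟩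

theorem range_cyl_inter (C : Set (Spec A)) (hC : C ∈ Set.range fun a : A => (cyl a).1)
    (D : Set (Spec A)) (hD : D ∈ Set.range fun a : A => (cyl a).1) :
    C ∩ D ∈ Set.range fun a : A => (cyl a).1 := by
  obtain ⟨a, rfl⟩ := hC
  obtain ⟨b, rfl⟩ := hD
  exact ⟨a ⊓ b, congrArg ClopenDown.toSet (cylHom.map_inf' a b)⟩

theorem isClopen_of_range_cyl (C : Set (Spec A)) (hC : C ∈ Set.range fun a : A => (cyl a).1) :
    IsClopen C := by
  obtain ⟨a, rfl⟩ := hC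
  exact isClopen_cyl a

theorem empty_mem_range_cyl : ∅ ∈ Set.range fun a : A => (cyl a).1 :=
  ⟨⊥, congrArg ClopenDown.toSet cylHom.map_bot'⟩

theorem univ_mem_range_cyl : Set.univ ∈ Set.range fun a : A => (cyl a).1 :=
  ⟨⊤, congrArg ClopenDown.toSet cylHom.map_top'⟩

/-- The sets `cyl a` form a bounded sublattice. By the choice of order on `Spec A` they separate
points of a downset from points outside it, so compactness applies. -/
theorem cyl_surjective : Function.Surjective (cyl (A := A)) := by
  intro W
  have h : W.1 ∈ Set.range fun a : A => (cyl a).1 := by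
    refine clopen_mem_of_separating W.2.1 _ isClopen_of_range_cyl empty_mem_range_cyl
      univ_mem_range_cyl range_cyl_union range_cyl_inter fun x hx y hy => ?_
    obtain ⟨a, ha⟩ := exists_cyl_of_not_le (x := x) (y := y) fun h => hy (W.2.2 h hx)
    exact ⟨_, ⟨a, rfl⟩, ha⟩
  obtain ⟨a, ha⟩ := h
  exact ⟨a, ClopenDown.toSet_injective ha⟩

/-- Induction on the clopen sets of the spectrum. -/
theorem clopen_induction_cyl {W : Set (Spec A)} (hW : IsClopen W) (P : Set (Spec A) → Prop)
    (huniv : P Set.univ) (hinter : ∀ C D, P C → P D → P (C ∩ D))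
    (hP : ∀ a b : A, P ((cyl a).1ᶜ ∪ (cyl b).1)) : P W := by
  refine clopen_induction hW P huniv hinter fun C D hC hC' hD hD' => ?_
  obtain ⟨a, ha⟩ := cyl_surjective ⟨C, hC, hC'⟩
  obtain ⟨b, hb⟩ := cyl_surjective ⟨D, hD, hD'⟩
  have := hP a b
  rwa [ha, hb] at this

/-- The prime filter theorem relative to a preorder that is compatible with the lattice operations. -/
theorem exists_of_not_rel (r : A → A → Prop) (hle : ∀ a b, a ≤ b → r a b)
    (htrans : ∀ a b c, r a b → r b c → r a c) (hinf : ∀ a b c, r c a → r c b → r c (a ⊓ b))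
    (hsup : ∀ a b c, r a c → r b c → r (a ⊔ b) c) {a b : A} (hab : ¬ r a b) :
    ∃ x : Spec A, x.val a = true ∧ x.val b = false ∧
      ∀ c d, r c d → x.val c = true → x.val d = true := by
  classical
  -- Ideals for `r` rather than for `≤`: the complement of a maximal one avoiding `a` is then a
  -- prime filter closed under `r`.
  let S : Set (Set A) := {J | (∀ c d, r c d → d ∈ J → c ∈ J) ∧ (∀ c ∈ J, ∀ d ∈ J, c ⊔ d ∈ J) ∧ a ∉ J}
  have hS : {c | r c b} ∈ S :=
    ⟨fun c d h h' => htrans c d b h h', fun c hc d hd => hsup c d b hc hd, hab⟩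
  obtain ⟨J, hbJ, hJ⟩ := zorn_subset_nonempty S (fun c hc hchain hne => by
    refine ⟨⋃₀ c, ⟨?_, ?_, ?_⟩, fun s hs => Set.subset_sUnion_of_mem hs⟩
    · rintro p q hpq ⟨I, hI, hq⟩
      exact ⟨I, hI, (hc hI).1 p q hpq hq⟩
    · rintro p ⟨I, hI, hp⟩ q ⟨I', hI', hq⟩
      obtain h | h := hchain.total hI hI'
      · exact ⟨I', hI', (hc hI').2.1 p (h hp) q hq⟩
      · exact ⟨I, hI, (hc hI).2.1 p hp q (h hq)⟩
    · rintro ⟨I, hI, ha⟩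
      exact (hc hI).2.2 ha) _ hS
  obtain ⟨hdown, hJsup, haJ⟩ := hJ.prop
  have hb : b ∈ J := hbJ (hle b b le_rfl)
  -- By maximality, the `r`-ideal generated by `J` and `c` must contain `a`.
  have hext : ∀ c, c ∉ J → ∃ j ∈ J, r a (j ⊔ c) := by
    intro c hc
    by_contra hno
    have hmem : {e | ∃ j ∈ J, r e (j ⊔ c)} ∈ S := by
      refine ⟨?_, ?_, hno⟩
      · rintro p q hpq ⟨j, hj, hq⟩
        exact ⟨j, hj, htrans _ _ _ hpq hq⟩
      · rintro p ⟨j, hj, hp⟩ q ⟨k, hk, hq⟩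
        refine ⟨j ⊔ k, hJsup j hj k hk, hsup _ _ _ (htrans _ _ _ hp (hle _ _ ?_))
          (htrans _ _ _ hq (hle _ _ ?_))⟩
        · exact sup_le_sup_right le_sup_left c
        · exact sup_le_sup_right le_sup_right c
    exact hc (hJ.2 hmem (fun e he => ⟨e, he, hle _ _ le_sup_left⟩) ⟨b, hb, hle _ _ le_sup_right⟩)
  have hprime : ∀ c d, c ⊓ d ∈ J → c ∈ J ∨ d ∈ J := by
    intro c d hcd
    by_contra h
    rw [not_or] at h
    obtain ⟨j, hj, hjc⟩ := hext c h.1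
    obtain ⟨k, hk, hkd⟩ := hext d h.2
    -- Distributivity enters here: `(j ⊔ k) ⊔ (c ⊓ d)` is a meet of two elements that are both
    -- `r`-above `a`.
    refine haJ (hdown _ _ ?_ (hJsup _ (hJsup j hj k hk) _ hcd))
    rw [sup_inf_left]
    exact hinf _ _ _ (htrans _ _ _ hjc (hle _ _ (sup_le_sup_right le_sup_left c)))
      (htrans _ _ _ hkd (hle _ _ (sup_le_sup_right le_sup_right d)))
  have hlow : ∀ c d, c ≤ d → d ∈ J → c ∈ J := fun c d h => hdown c d (hle c d h)
  refine ⟨⟨fun c => decide (c ∉ J), ⟨?_, ?_⟩, fun c d => ?_, fun c d => ?_⟩, ?_, ?_, fun c d hcd => ?_⟩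
  · exact decide_eq_true fun h => haJ (hlow _ _ le_top h)
  · exact decide_eq_false fun h => h (hlow _ _ bot_le hb)
  · rw [Bool.eq_iff_iff, Bool.or_eq_true]
    simp only [decide_eq_true_eq]
    have h1 := hlow c _ (le_sup_left : c ≤ c ⊔ d)
    have h2 := hlow d _ (le_sup_right : d ≤ c ⊔ d)
    have h3 := hJsup c
    grind
  · rw [Bool.eq_iff_iff, Bool.and_eq_true]
    simp only [decide_eq_true_eq]
    have h1 := hlow _ c (inf_le_left : c ⊓ d ≤ c)
    have h2 := hlow _ d (inf_le_right : c ⊓ d ≤ d)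
    have h3 := hprime c d
    grind
  · exact decide_eq_true haJ
  · exact decide_eq_false fun h => h hb
  · simp only [decide_eq_true_eq]
    exact fun hc hd => hc (hdown c d hcd hd)

theorem cyl_injective : Function.Injective (cyl (A := A)) := by
  have key : ∀ a b : A, cyl a = cyl b → a ≤ b := by
    intro a b h
    by_contra hab
    obtain ⟨x, ha, hb, -⟩ := exists_of_not_rel (· ≤ ·) (fun _ _ h => h) (fun _ _ _ => le_trans)
      (fun _ _ _ => le_inf) (fun _ _ _ => sup_le) hab
    have : x ∈ (cyl b).1 := h ▸ (show x ∈ (cyl a).1 from ha)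
    exact Bool.false_ne_true (hb.symm.trans this)
  exact fun a b h => (key a b h).antisymm (key b a h.symm)

end Spec

/-! ### From algebras to spaces -/

namespace WeakHeytAlg

variable (A : WeakHeytAlg.{u})

theorem imp_eq_top {a b : A.lat} (h : a ≤ b) : A.imp a b = ⊤ := by
  have := A.imp_inf a a b
  rwa [inf_eq_left.2 h, imp_self, top_inf_eq, eq_comm] at this

/-- The relation on the spectrum of a weak Heyting algebra. -/
def specR (x y : Spec A.lat) : Prop :=
  ∀ a b : A.lat, x.val (A.imp a b) = true → y.val a = true → y.val b = true

/-- For fixed `x`, the axioms say that `a → b ∈ x` satisfies the hypotheses of `exists_of_not_rel`.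
If `a → b ∉ x`, the prime filter obtained is an `R`-successor of `x` containing `a` but not `b`. -/
theorem val_imp_iff (x : Spec A.lat) (a b : A.lat) :
    x.val (A.imp a b) = true ↔ ∀ y, A.specR x y → y.val a = true → y.val b = true := by
  refine ⟨fun h y hy => hy a b h, fun h => ?_⟩
  by_contra hx
  obtain ⟨y, hya, hyb, hy⟩ := Spec.exists_of_not_rel (fun c d => x.val (A.imp c d) = true)
    (fun c d hcd => by rw [A.imp_eq_top hcd]; exact x.prop.1.1)
    (fun c d e h1 h2 => x.val_mono (A.imp_trans c d e) (by rw [x.prop.2.2, h1, h2]; rfl))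
    (fun c d e h1 h2 => by rw [A.imp_inf, x.prop.2.2, h1, h2]; rfl)
    (fun c d e h1 h2 => by rw [A.sup_imp, x.prop.2.2, h1, h2]; rfl) hx
  exact Bool.false_ne_true (hyb.symm.trans (h y hy hya))

theorem specR_subset_iff (x : Spec A.lat) (a b : A.lat) :
    {y | A.specR x y} ⊆ (Spec.cyl a).1ᶜ ∪ (Spec.cyl b).1 ↔ x.val (A.imp a b) = true :=
  (forall₂_congr fun _ _ => imp_iff_not_or.symm).trans (A.val_imp_iff x a b).symm

theorem isClopen_specR_box {U : Set (Spec A.lat)} (hU : IsClopen U) :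
    IsClopen {x | {y | A.specR x y} ⊆ U} := by
  refine Spec.clopen_induction_cyl hU (fun U => IsClopen {x | {y | A.specR x y} ⊆ U}) ?_ ?_ ?_
  · simp only [Set.subset_univ]
    exact isClopen_univ
  · intro C D hC hD
    simp only [Set.subset_inter_iff]
    exact hC.inter hD
  · intro a b
    simp only [specR_subset_iff]
    exact Spec.isClopen_cyl _

/-- The dual weak Heyting space of a weak Heyting algebra. -/
def specSp : WeakHeytSp.{u} where
  space := { carrier := Spec A.lat }
  R := A.specR
  isClosed_R x := by
    have : {y | A.specR x y} = ⋂ (a : A.lat) (b : A.lat) (_ : x.val (A.imp a b) = true),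
        ((Spec.cyl a).1ᶜ ∪ (Spec.cyl b).1) := by
      ext y
      simp only [Set.mem_iInter]
      exact forall₃_congr fun _ _ _ => imp_iff_not_or
    rw [this]
    exact isClosed_iInter fun a => isClosed_iInter fun b => isClosed_iInter fun _ =>
      ((Spec.isClopen_cyl a).compl.union (Spec.isClopen_cyl b)).isClosed
  R_mono _ _ _ hxy hz a b hy := hz a b (hxy _ hy)
  isClopen_box _ hU := A.isClopen_specR_box hU
  isClopen_diamond U hU := by
    rw [← isClopen_compl_iff]
    convert A.isClopen_specR_box hU.compl using 1
    ext x
    simp only [Set.mem_compl_iff, Set.mem_ofPred_eq, Set.not_nonempty_iff_eq_empty]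
    exact Set.disjoint_iff_inter_eq_empty.symm.trans Set.subset_compl_iff_disjoint_right.symm

/-- Since `R(x) ⊆ cyl c` means `1 → c ∈ x`, the axiom `1 → 0 = 0` makes `R(x)` nonempty.
Preservation of joins, with primeness of `x`, makes it prime for unions of clopen downsets. -/
theorem isPreHeyting_specSp (h : A.isPreHeyting) : A.specSp.isPreHeyting := by
  intro (x : Spec A.lat)
  have hsub : ∀ c : A.lat, {y | A.specR x y} ⊆ (Spec.cyl c).1 ↔ x.val (A.imp ⊤ c) = true := by
    intro c
    rw [val_imp_iff]
    exact ⟨fun h y hy _ => h hy, fun h y hy => h y hy y.prop.1.1⟩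
  refine isRooted_of_prime (X := Spec A.lat) (A.specSp.isClosed_R x) ?_
    fun C D hC hC' hD hD' hCD => ?_
  · by_contra hne
    have : x.val (A.imp ⊤ ⊥) = true :=
      (A.val_imp_iff x ⊤ ⊥).2 fun y hy => (hne ⟨y, hy⟩).elim
    rw [h.1, x.prop.1.2] at this
    exact Bool.false_ne_true this
  · obtain ⟨c, hc⟩ := Spec.cyl_surjective ⟨C, hC, hC'⟩
    obtain ⟨d, hd⟩ := Spec.cyl_surjective ⟨D, hD, hD'⟩
    obtain rfl : (Spec.cyl c).1 = C := congrArg ClopenDown.toSet hc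
    obtain rfl : (Spec.cyl d).1 = D := congrArg ClopenDown.toSet hd
    have h' : {y | A.specR x y} ⊆ (Spec.cyl (c ⊔ d)).1 := by
      rw [show Spec.cyl (c ⊔ d) = Spec.cyl c ⊔ Spec.cyl d from map_sup Spec.cylHom c d]
      exact hCD
    rw [hsub, ← h.2, x.prop.2.1, Bool.or_eq_true] at h'
    exact h'.imp (hsub c).2 (hsub d).2

/-- A bijective homomorphism of weak Heyting algebras is an isomorphism. -/
noncomputable def isoOfBijective {A B : WeakHeytAlg.{u}} (f : Hom A B)
    (hf : Function.Bijective f.hom) : A ≅ B where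
  hom := f
  inv :=
    { hom :=
        { toFun := (Equiv.ofBijective f.hom hf).symm
          map_sup' := fun a b => hf.1 (by
            rw [map_sup f.hom]; simp only [Equiv.ofBijective_apply_symm_apply])
          map_inf' := fun a b => hf.1 (by
            rw [map_inf f.hom]; simp only [Equiv.ofBijective_apply_symm_apply])
          map_top' := hf.1 (by
            rw [map_top f.hom]; exact Equiv.ofBijective_apply_symm_apply _ hf _)
          map_bot' := hf.1 (by
            rw [map_bot f.hom]; exact Equiv.ofBijective_apply_symm_apply _ hf _) }
      map_imp := fun a b => hf.1 ((Equiv.ofBijective_apply_symm_apply _ hf _).trans (by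
        rw [f.map_imp]
        exact congrArg₂ B.imp (Equiv.ofBijective_apply_symm_apply _ hf _).symm
          (Equiv.ofBijective_apply_symm_apply _ hf _).symm)) }
  hom_inv_id := Hom.ext (DFunLike.ext _ _ (Equiv.ofBijective_symm_apply_apply _ hf))
  inv_hom_id := Hom.ext (DFunLike.ext _ _ (Equiv.ofBijective_apply_symm_apply _ hf))

/-- A weak Heyting algebra is isomorphic to the clopen downsets of its dual space. -/
noncomputable def isoClopenDown : A ≅ A.specSp.clopenDown :=
  isoOfBijective
    { hom := Spec.cylHom (A := A.lat)
      map_imp := fun a b => ClopenDown.ext fun x => (A.specR_subset_iff x a b).symm }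
    ⟨Spec.cyl_injective, Spec.cyl_surjective⟩

end WeakHeytAlg

instance : clopenDownFunctor.{u}.EssSurj where
  mem_essImage Y := ⟨⟨Y.unop.obj.specSp, Y.unop.obj.isPreHeyting_specSp Y.unop.property⟩,
    ⟨Iso.op (ObjectProperty.isoMk _ (WeakHeytAlg.isoClopenDown Y.unop.obj))⟩⟩

instance : clopenDownFunctor.{u}.IsEquivalence where

end PHey

theorem theorem6p5 :
    Nonempty (PHey.PreHeytAlg.{u}ᵒᵖ ≌ PHey.PreHeytSp.{u}) ∧
      Nonempty (Cat.of PHey.PreHeytSp.{u} ≅ Cat.of (Endofunctor.Coalgebra PHey.rootedVietoris.{u})) :=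
  ⟨⟨PHey.clopenDownFunctor.asEquivalence.symm⟩, ⟨PHey.PreHeytSp.isoCoalgebra⟩⟩
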